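/- Let $\mathbb X$ be a complex Banach space, $\mathbb R^+=[0,\infty)$, $BC=BC(\mathbb R^+,\mathbb X)$ the space of bounded continuous functions with the supremum norm, and $C_0=\{g\in BC:\lim_{t\to\infty}g(t)=0\}$. Functions on a half-line are extended to $\mathbb R$ by zero. A linear subspace $\mathcal F\subset BC$ satisfies Condition $F^{++}$ if (i) $\mathcal F$ is closed in $BC$ and contains $C_0$; (ii) $t\mapsto e^{i\xi t}g(t)$ is in $\mathcal F$ for all $g\in\mathcal F$, $\xi\in\mathbb R$; (iii) for all $h\in\mathcal F$, $\operatorname{Re}\lambda>0$, $\operatorname{Re}\eta<0$, the functions $t\mapsto\int_t^\infty e^{\lambda(t-s)}h(s)\,ds$ and $t\mapsto\int_0^t e^{\eta(t-s)}h(s)\,ds$ on $\mathbb R^+$ are in $\mathcal F$; (iv) $t\mapsto Bg(t)$ is in $\mathcal F$ for all $g\in\mathcal F$ and all bounded linear operators $B$ on $\mathbb X$; (v) for all $\psi\in L^1((-\infty,0])$ and $g\in\mathcal F$, the restriction to $\mathbb R^+$ of $\psi*g$ is in $\mathcal F$. Let $A$ be a closed (not necessarily bounded or densely defined) linear operator on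 $\mathbb X$ with domain $D(A)$ and spectrum $\sigma(A)$, and let $f,u\in BC$. Suppose that $u$ is a mild solution of $u'=Au+f$ on $\mathbb R^+$, i.e. for all $t\ge0$, $\int_0^tu(s)\,ds\in D(A)$ and $u(t)-u(0)=A\int_0^tu(s)\,ds+\int_0^tf(s)\,ds$. Let $\phi\in L^1(\mathbb R^+)$ be of spectral synthesis with respect to $E=i\sigma(A)\cap\mathbb R$, i.e. there are $\phi_n\in L^1(\mathbb R)$ with $\|\phi-\phi_n\|_{L^1(\mathbb R)}\to0$ such that each Fourier transform $\xi\mapsto\int_{\mathbb R}e^{-i\xi s}\phi_n(s)\,ds$ vanishes on a neighborhood of $E$. Put $w(t)=\int_0^\infty\phi(s)u(t+s)\,ds$ for $t\ge0$. Then, for every $\mathcal F$ satisfying Condition $F^{++}$ with $f\in\mathcal F$, one has $w\in\mathcal F$. In particular, if $f\in C_0$, then $w(t)\to0$ as $t\to\infty$. -/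

import Mathlib

open MeasureTheory Filter Topology
open scoped NNReal BoundedContinuousFunction

noncomputable section

namespace EvolEq

variable {X : Type*} [NormedAddCommGroup X] [NormedSpace ℂ X]

/-- The resolvent set of a (possibly unbounded) linear operator `A` on `X`: all `z` such that
`z - A : D(A) → X` is bijective with a bounded inverse `R`. -/
def resolventSet (A : X →ₗ.[ℂ] X) : Set ℂ :=
  {z | ∃ R : X →L[ℂ] X,
    (∀ x : X, ∃ h : R x ∈ A.domain, z • R x - A ⟨R x, h⟩ = x) ∧
    (∀ x : A.domain, R (z • (x : X) - A x) = x)}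

/-- The spectrum `σ(A)` of a linear operator on `X`. -/
def spectrum (A : X →ₗ.[ℂ] X) : Set ℂ := (resolventSet A)ᶜ

/-- The set `iσ(A) ∩ ℝ` of real numbers. -/
def rotatedRealSpectrum (A : X →ₗ.[ℂ] X) : Set ℝ :=
  {ξ | ∃ z ∈ spectrum A, Complex.I * z = (ξ : ℂ)}

/-- The extension of a function on `[0, ∞)` by zero to the real line. -/
def zeroExt (g : ℝ≥0 → X) (t : ℝ) : X := if 0 ≤ t then g t.toNNReal else 0

/-- `u` is a mild solution of `u' = A u + f` on `[0, ∞)`. -/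
def IsMildSolution (A : X →ₗ.[ℂ] X) (f u : ℝ≥0 →ᵇ X) : Prop :=
  ∀ t : ℝ≥0, ∃ h : (∫ s in (0 : ℝ)..t, zeroExt u s) ∈ A.domain,
    u t - u 0 = A ⟨∫ s in (0 : ℝ)..t, zeroExt u s, h⟩ + ∫ s in (0 : ℝ)..t, zeroExt f s

/-- The function `g` on `[0, ∞)` is (bounded, continuous and) an element of the space `F`. -/
def MemSpace (g : ℝ≥0 → X) (F : Submodule ℂ (ℝ≥0 →ᵇ X)) : Prop :=
  ∃ G ∈ F, ∀ t, G t = g t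

/-- Condition `F⁺` for a linear subspace `F` of `BC([0, ∞), X)`. -/
structure ConditionFPlus (F : Submodule ℂ (ℝ≥0 →ᵇ X)) : Prop where
  isClosed : IsClosed (F : Set (ℝ≥0 →ᵇ X))
  contains_C0 : ∀ g : ℝ≥0 →ᵇ X, Tendsto g atTop (𝓝 0) → g ∈ F
  modulation : ∀ g ∈ F, ∀ ξ : ℝ,
    MemSpace (fun t : ℝ≥0 => Complex.exp (Complex.I * ξ * (t : ℝ)) • g t) F
  forward : ∀ h ∈ F, ∀ z : ℂ, 0 < z.re →
    MemSpace (fun t : ℝ≥0 =>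
      ∫ s in Set.Ioi (t : ℝ), Complex.exp (z * ((t : ℝ) - s)) • zeroExt h s) F
  backward : ∀ h ∈ F, ∀ z : ℂ, z.re < 0 →
    MemSpace (fun t : ℝ≥0 =>
      ∫ s in (0 : ℝ)..t, Complex.exp (z * ((t : ℝ) - s)) • zeroExt h s) F
  comp_left : ∀ B : X →L[ℂ] X, ∀ g ∈ F, MemSpace (fun t => B (g t)) F

/-- Condition `F⁺⁺`: Condition `F⁺`, and `F` is stable under convolution with every
`ψ ∈ L¹((-∞, 0])` (all functions being extended by zero to `ℝ`). -/
structure ConditionFPlusPlus (F : Submodule ℂ (ℝ≥0 →ᵇ X)) : Prop extends ConditionFPlus F where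
  convolution : ∀ ψ : ℝ → ℂ, Integrable ψ → (∀ t, 0 < t → ψ t = 0) → ∀ g ∈ F,
    MemSpace (fun t : ℝ≥0 => ∫ s : ℝ, ψ ((t : ℝ) - s) • zeroExt g s) F

/-- The Fourier transform `ξ ↦ ∫ e^{-iξs} g(s) ds` of `g ∈ L¹(ℝ)`. -/
def fourierL1 (g : ℝ → ℂ) (ξ : ℝ) : ℂ := ∫ s : ℝ, Complex.exp (-(Complex.I * ξ * s)) * g s

/-- `g ∈ L¹(ℝ)` is of spectral synthesis with respect to `E`. -/
def IsOfSpectralSynthesis (g : ℝ → ℂ) (E : Set ℝ) : Prop :=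
  Integrable g ∧ ∃ gn : ℕ → ℝ → ℂ, (∀ n, Integrable (gn n)) ∧
    Tendsto (fun n => ∫ s : ℝ, ‖g s - gn n s‖) atTop (𝓝 0) ∧
    ∀ n, ∃ U : Set ℝ, IsOpen U ∧ E ⊆ U ∧ ∀ ξ ∈ U, fourierL1 (gn n) ξ = 0

end EvolEq

end

/-! Reflecting the kernel turns `w` into the convolution of `φ(-·)` with the zero extension of `u`,
so the question is which kernels filter `u` into `F`. The backward exponential integrals and
condition (v) together make `F` stable under every `L¹` kernel
(`ConditionFPlusPlus.isStableKernel`).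

The heart is local (`exists_memSpace_conv`). Let `2πib` be a resolvent point with inverse `R`, and
let `θ` have its spectrum close to `b`. Integration by parts in the mild equation gives `h = R(-(θ'
- 2πibθ)*u + θ*f + θ(t)u(0))` for `h = θ*u`. By a Bernstein factorisation `θ' - 2πibθ = k*θ` with
`‖k‖₁` small, so `h = R(-k*h)` modulo `F`. Hence the distance from `h` to `F` is at most half of
itself, and `h ∈ F`.

A partition of unity glues the local results into one for band-limited kernels whose transform
vanishes near the imaginary spectrum (`memSpace_conv_conv`). Uniform approximation removes the band
limit, and spectral synthesis passes from `φₙ` to `φ`. For `f ∈ C₀`, take `F = C₀`. -/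

namespace EvolEq

variable {X : Type*} [NormedAddCommGroup X]

/-! ### Convolution of integrable kernels with bounded functions -/

/-- Bounded functions on the line, continuous except possibly at the origin. -/
structure IsTame (h : ℝ → X) : Prop where
  continuousAt : ∀ t, t ≠ 0 → ContinuousAt h t
  bounded : ∃ C, ∀ t, ‖h t‖ ≤ C

namespace IsTame

variable {h g : ℝ → X}

theorem of_continuous (hc : Continuous h) {C : ℝ} (hb : ∀ t, ‖h t‖ ≤ C) : IsTame h :=
  ⟨fun _ _ => hc.continuousAt, C, hb⟩

theorem aestronglyMeasurable (hh : IsTame h) : AEStronglyMeasurable h := by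
  have h1 : ContinuousOn h {0}ᶜ := fun t ht => (hh.continuousAt t ht).continuousWithinAt
  have h2 := h1.aestronglyMeasurable (μ := volume) (measurableSet_singleton (0 : ℝ)).compl
  rwa [Measure.restrict_eq_self_of_ae_mem] at h2
  exact compl_mem_ae_iff.2 (by simp)

theorem comp_sub (hh : IsTame h) (t : ℝ) : AEStronglyMeasurable fun s => h (t - s) :=
  hh.aestronglyMeasurable.comp_quasiMeasurePreserving
    (quasiMeasurePreserving_sub_left_of_right_invariant volume t)

theorem add (hh : IsTame h) (hg : IsTame g) : IsTame fun t => h t + g t := by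
  obtain ⟨C, hC⟩ := hh.bounded
  obtain ⟨D, hD⟩ := hg.bounded
  exact ⟨fun t ht => (hh.continuousAt t ht).add (hg.continuousAt t ht), C + D,
    fun t => (norm_add_le _ _).trans (add_le_add (hC t) (hD t))⟩

theorem sub (hh : IsTame h) (hg : IsTame g) : IsTame fun t => h t - g t := by
  obtain ⟨C, hC⟩ := hh.bounded
  obtain ⟨D, hD⟩ := hg.bounded
  exact ⟨fun t ht => (hh.continuousAt t ht).sub (hg.continuousAt t ht), C + D,
    fun t => (norm_sub_le _ _).trans (add_le_add (hC t) (hD t))⟩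

theorem indicator_Ici (hh : IsTame h) : IsTame ((Set.Ici 0).indicator h) := by
  obtain ⟨C, hC⟩ := hh.bounded
  refine ⟨fun t ht => ?_, C, fun t => (norm_indicator_le_norm_self _ _).trans (hC t)⟩
  rcases lt_or_gt_of_ne ht with h0 | h0
  · refine (continuousAt_const (y := (0 : X))).congr ?_
    filter_upwards [gt_mem_nhds h0] with s hs
    rw [Set.indicator_of_notMem]
    simpa using hs
  · refine (hh.continuousAt t ht).congr ?_
    filter_upwards [lt_mem_nhds h0] with s hs
    rw [Set.indicator_of_mem]
    exact le_of_lt hs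

end IsTame

theorem zeroExt_eq_indicator (g : ℝ≥0 → X) :
    zeroExt g = (Set.Ici 0).indicator fun t : ℝ => g t.toNNReal := by
  ext t
  simp [zeroExt, Set.indicator]

@[simp] theorem zeroExt_coe (g : ℝ≥0 → X) (t : ℝ≥0) : zeroExt g t = g t := by simp [zeroExt]

theorem zeroExt_of_neg (g : ℝ≥0 → X) {t : ℝ} (ht : t < 0) : zeroExt g t = 0 := by
  simp [zeroExt, ht.not_ge]

theorem norm_zeroExt_le (g : ℝ≥0 →ᵇ X) (t : ℝ) : ‖zeroExt g t‖ ≤ ‖g‖ := by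
  rw [zeroExt_eq_indicator]
  exact (norm_indicator_le_norm_self _ _).trans (g.norm_coe_le_norm _)

/-- The extension jumps at the origin unless `g 0 = 0`; this is the discontinuity that `IsTame`
allows. -/
theorem isTame_zeroExt (g : ℝ≥0 →ᵇ X) : IsTame (zeroExt g) := by
  rw [zeroExt_eq_indicator]
  exact (IsTame.of_continuous (g.continuous.comp continuous_real_toNNReal)
    fun t => g.norm_coe_le_norm _).indicator_Ici

variable [NormedSpace ℂ X]

namespace IsTame

variable {h : ℝ → X}

theorem const_smul (hh : IsTame h) (c : ℂ) : IsTame fun t => c • h t := by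
  obtain ⟨C, hC⟩ := hh.bounded
  exact ⟨fun t ht => (hh.continuousAt t ht).const_smul c, ‖c‖ * C,
    fun t => (norm_smul_le _ _).trans (by gcongr; exact hC t)⟩

theorem clm_comp (hh : IsTame h) (B : X →L[ℂ] X) : IsTame fun t => B (h t) := by
  obtain ⟨C, hC⟩ := hh.bounded
  exact ⟨fun t ht => B.continuous.continuousAt.comp (hh.continuousAt t ht), ‖B‖ * C,
    fun t => (B.le_opNorm _).trans (by gcongr; exact hC t)⟩

end IsTame

/-- Convolution on the real line of a scalar kernel with a vector-valued function. -/
noncomputable def conv (ψ : ℝ → ℂ) (h : ℝ → X) (t : ℝ) : X := ∫ s, ψ s • h (t - s)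

theorem conv_eq_convolution (ψ : ℝ → ℂ) (h : ℝ → X) :
    conv ψ h = MeasureTheory.convolution ψ h (ContinuousLinearMap.lsmul ℂ ℂ) volume := rfl

theorem conv_swap (ψ : ℝ → ℂ) (h : ℝ → X) (t : ℝ) : conv ψ h t = ∫ s, ψ (t - s) • h s := by
  rw [conv_eq_convolution, convolution_lsmul_swap]

section conv

variable {ψ θ : ℝ → ℂ} {h g : ℝ → X}

theorem integrable_smul_comp_sub (hψ : Integrable ψ) (hh : IsTame h) (t : ℝ) :
    Integrable fun s => ψ s • h (t - s) := by
  obtain ⟨C, hC⟩ := hh.bounded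
  exact hψ.smul_bdd C (hh.comp_sub t) (Eventually.of_forall fun s => hC _)

theorem norm_conv_le (hψ : Integrable ψ) {C : ℝ} (hC : ∀ t, ‖h t‖ ≤ C) (t : ℝ) :
    ‖conv ψ h t‖ ≤ (∫ s, ‖ψ s‖) * C := by
  rw [← integral_mul_const]
  refine norm_integral_le_of_norm_le (hψ.norm.mul_const C) (Eventually.of_forall fun s => ?_)
  rw [norm_smul]
  gcongr
  exact hC _

theorem continuous_conv (hψ : Integrable ψ) (hh : IsTame h) : Continuous (conv ψ h) := by
  obtain ⟨C, hC⟩ := hh.bounded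
  refine continuous_iff_continuousAt.2 fun t => ?_
  refine continuousAt_of_dominated (bound := fun s => ‖ψ s‖ * C)
    (Eventually.of_forall fun x => (integrable_smul_comp_sub hψ hh x).aestronglyMeasurable)
    (Eventually.of_forall fun x => Eventually.of_forall fun s => ?_) (hψ.norm.mul_const C) ?_
  · rw [norm_smul]
    gcongr
    exact hC _
  -- The jump of `h` is met only at `s = t`, a null set, so dominated convergence still applies.
  · have : ∀ᵐ s : ℝ, s ≠ t := compl_mem_ae_iff.2 (measure_singleton t)
    filter_upwards [this] with s hs
    refine continuousAt_const.smul ?_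
    have h1 : ContinuousAt h (t - s) := hh.continuousAt _ (sub_ne_zero.2 hs.symm)
    exact ContinuousAt.comp (f := fun x => x - s) h1 (by fun_prop)

theorem isTame_conv (hψ : Integrable ψ) (hh : IsTame h) : IsTame (conv ψ h) := by
  obtain ⟨C, hC⟩ := hh.bounded
  exact IsTame.of_continuous (continuous_conv hψ hh) (norm_conv_le hψ hC)

theorem conv_add (hψ : Integrable ψ) (hh : IsTame h) (hg : IsTame g) (t : ℝ) :
    conv ψ (fun s => h s + g s) t = conv ψ h t + conv ψ g t := by
  simp only [conv, smul_add]
  exact integral_add (integrable_smul_comp_sub hψ hh t) (integrable_smul_comp_sub hψ hg t)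

theorem conv_sub (hψ : Integrable ψ) (hh : IsTame h) (hg : IsTame g) (t : ℝ) :
    conv ψ (fun s => h s - g s) t = conv ψ h t - conv ψ g t := by
  simp only [conv, smul_sub]
  exact integral_sub (integrable_smul_comp_sub hψ hh t) (integrable_smul_comp_sub hψ hg t)

theorem conv_const_smul (c : ℂ) (t : ℝ) :
    conv ψ (fun s => c • h s) t = c • conv ψ h t := by
  simp only [conv, smul_comm _ c]
  exact integral_smul _ _

theorem sub_conv (hψ : Integrable ψ) (hθ : Integrable θ) (hh : IsTame h) (t : ℝ) :
    conv (fun s => ψ s - θ s) h t = conv ψ h t - conv θ h t := by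
  simp only [conv, sub_smul]
  exact integral_sub (integrable_smul_comp_sub hψ hh t) (integrable_smul_comp_sub hθ hh t)

theorem add_conv (hψ : Integrable ψ) (hθ : Integrable θ) (hh : IsTame h) (t : ℝ) :
    conv (fun s => ψ s + θ s) h t = conv ψ h t + conv θ h t := by
  simp only [conv, add_smul]
  exact integral_add (integrable_smul_comp_sub hψ hh t) (integrable_smul_comp_sub hθ hh t)

theorem const_mul_conv (c : ℂ) (t : ℝ) :
    conv (fun s => c * ψ s) h t = c • conv ψ h t := by
  simp only [conv, mul_smul]
  exact integral_smul _ _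

theorem sum_conv {ι : Type*} (s : Finset ι) {θ : ι → ℝ → ℂ} (hθ : ∀ i, Integrable (θ i))
    (hh : IsTame h) (t : ℝ) :
    conv (fun r => ∑ i ∈ s, θ i r) h t = ∑ i ∈ s, conv (θ i) h t := by
  simp only [conv, Finset.sum_smul]
  exact integral_finsetSum _ fun i _ => integrable_smul_comp_sub (hθ i) hh t

theorem clm_conv [CompleteSpace X] (B : X →L[ℂ] X) (hψ : Integrable ψ) (hh : IsTame h) (t : ℝ) :
    B (conv ψ h t) = conv ψ (fun s => B (h s)) t := by
  simp only [conv, ← map_smul]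
  exact (B.integral_comp_comm (integrable_smul_comp_sub hψ hh t)).symm

theorem integrable_conv (hψ : Integrable ψ) (hθ : Integrable θ) : Integrable (conv ψ θ) := by
  rw [conv_eq_convolution]
  exact hψ.integrable_convolution _ hθ

theorem conv_assoc [CompleteSpace X] (hψ : Integrable ψ) (hθ : Integrable θ) (hh : IsTame h)
    (t : ℝ) : conv (conv ψ θ) h t = conv ψ (conv θ h) t := by
  simp only [conv_eq_convolution]
  refine convolution_assoc' _ _ _ _ (fun x y z => by simp [smul_smul, mul_comm])
    (hψ.ae_convolution_exists _ hθ)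
    (Eventually.of_forall fun s => integrable_smul_comp_sub hθ hh s) ?_
  obtain ⟨C, hC⟩ := hh.bounded
  -- Fubini requires joint integrability: an integrable scalar function on the plane times a bounded
  -- vector factor.
  have h1 := hψ.convolution_integrand (ContinuousLinearMap.lsmul ℂ ℂ) hθ
  have h2 : AEStronglyMeasurable (fun p : ℝ × ℝ => h (t - p.1)) (volume.prod volume) :=
    (hh.comp_sub t).comp_fst
  have h3 := h1.smul_bdd C h2 (Eventually.of_forall fun s => hC _)
  refine h3.congr (Eventually.of_forall fun p => ?_)
  simp [Function.uncurry, smul_smul, mul_comm]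

theorem conv_comm (ψ θ : ℝ → ℂ) : conv ψ θ = conv θ ψ := by
  ext t
  rw [conv_swap]
  simp only [conv, smul_eq_mul, mul_comm]

/-- Convolution with an integrable kernel preserves decay at infinity. -/
theorem tendsto_conv (hψ : Integrable ψ) (hh : IsTame h) (h0 : Tendsto h atTop (𝓝 0)) :
    Tendsto (conv ψ h) atTop (𝓝 0) := by
  obtain ⟨C, hC⟩ := hh.bounded
  have : Tendsto (conv ψ h) atTop (𝓝 (∫ _ : ℝ, (0 : X))) := by
    refine tendsto_integral_filter_of_dominated_convergence (fun s => ‖ψ s‖ * C)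
      (Eventually.of_forall fun x => (integrable_smul_comp_sub hψ hh x).aestronglyMeasurable)
      (Eventually.of_forall fun x => Eventually.of_forall fun s => ?_) (hψ.norm.mul_const C)
      (Eventually.of_forall fun s => ?_)
    · rw [norm_smul]
      gcongr
      exact hC _
    · have h1 : Tendsto (fun t : ℝ => t - s) atTop atTop :=
        tendsto_atTop_add_const_right _ _ tendsto_id
      simpa using (h0.comp h1).const_smul (ψ s)
  simpa using this

end conv

end EvolEq

namespace EvolEq

variable {X : Type*} [NormedAddCommGroup X] [NormedSpace ℂ X]

/-! ### Stability of translation-closed spaces under convolution -/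

section MemSpace

variable {F : Submodule ℂ (ℝ≥0 →ᵇ X)} {g h : ℝ≥0 → X}

theorem MemSpace.add (hg : MemSpace g F) (hh : MemSpace h F) :
    MemSpace (fun t => g t + h t) F := by
  obtain ⟨G, hG, hGg⟩ := hg
  obtain ⟨H, hH, hHh⟩ := hh
  exact ⟨G + H, F.add_mem hG hH, fun t => by simp [hGg, hHh]⟩

theorem MemSpace.smul (hg : MemSpace g F) (c : ℂ) : MemSpace (fun t => c • g t) F := by
  obtain ⟨G, hG, hGg⟩ := hg
  exact ⟨c • G, F.smul_mem c hG, fun t => by simp [hGg]⟩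

theorem MemSpace.congr (hg : MemSpace g F) (hgh : ∀ t, g t = h t) : MemSpace h F := by
  obtain ⟨G, hG, hGg⟩ := hg
  exact ⟨G, hG, fun t => by rw [hGg, hgh]⟩

theorem memSpace_sum {ι : Type*} (s : Finset ι) {g : ι → ℝ≥0 → X}
    (hg : ∀ i ∈ s, MemSpace (g i) F) : MemSpace (fun t => ∑ i ∈ s, g i t) F := by
  classical
  induction s using Finset.induction_on with
  | empty => exact ⟨0, F.zero_mem, fun t => by simp⟩
  | insert i s his ih =>
    refine ((hg i (by simp)).add (ih fun j hj => hg j (by simp [hj]))).congr fun t => ?_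
    rw [Finset.sum_insert his]

/-- A continuous function which is a uniform limit of elements of a closed space belongs to it. -/
theorem MemSpace.of_approx (hF : IsClosed (F : Set (ℝ≥0 →ᵇ X))) (hg : Continuous g)
    (happ : ∀ ε > 0, ∃ g', MemSpace g' F ∧ ∀ t, ‖g t - g' t‖ ≤ ε) : MemSpace g F := by
  have hb : ∃ C, ∀ t, ‖g t‖ ≤ C := by
    obtain ⟨g', ⟨G, -, hG⟩, h1⟩ := happ 1 one_pos
    refine ⟨1 + ‖G‖, fun t => ?_⟩
    calc ‖g t‖ = ‖(g t - g' t) + G t‖ := by rw [hG, sub_add_cancel]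
      _ ≤ 1 + ‖G‖ := (norm_add_le _ _).trans (add_le_add (h1 t) (G.norm_coe_le_norm t))
  obtain ⟨C, hC⟩ := hb
  let G₀ : ℝ≥0 →ᵇ X := BoundedContinuousFunction.ofNormedAddCommGroup g hg C hC
  refine ⟨G₀, ?_, fun t => rfl⟩
  have : G₀ ∈ closure (F : Set (ℝ≥0 →ᵇ X)) := by
    refine Metric.mem_closure_iff.2 fun ε hε => ?_
    obtain ⟨g', ⟨G, hGF, hG⟩, h1⟩ := happ (ε / 2) (by positivity)
    refine ⟨G, hGF, lt_of_le_of_lt ((BoundedContinuousFunction.dist_le (by positivity)).2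
      fun t => ?_) (half_lt_self hε)⟩
    rw [dist_eq_norm, hG]
    exact h1 t
  rwa [hF.closure_eq] at this

end MemSpace

theorem ConditionFPlus.memSpace_of_tendsto {F : Submodule ℂ (ℝ≥0 →ᵇ X)} (hF : ConditionFPlus F)
    {g : ℝ≥0 → X} (hg : Continuous g) {C : ℝ} (hC : ∀ t, ‖g t‖ ≤ C)
    (h0 : Tendsto g atTop (𝓝 0)) : MemSpace g F :=
  ⟨BoundedContinuousFunction.ofNormedAddCommGroup g hg C hC,
    hF.contains_C0 _ h0, fun _ => rfl⟩

/-- Integrable kernels whose convolution operator leaves the space `F` invariant. -/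
def IsStableKernel (F : Submodule ℂ (ℝ≥0 →ᵇ X)) (ψ : ℝ → ℂ) : Prop :=
  Integrable ψ ∧ ∀ g ∈ F, MemSpace (fun t : ℝ≥0 => conv ψ (zeroExt g) t) F

namespace IsStableKernel

variable {F : Submodule ℂ (ℝ≥0 →ᵇ X)} {ψ θ : ℝ → ℂ}

theorem add (hψ : IsStableKernel F ψ) (hθ : IsStableKernel F θ) :
    IsStableKernel F fun s => ψ s + θ s :=
  ⟨hψ.1.add hθ.1, fun g hg => ((hψ.2 g hg).add (hθ.2 g hg)).congr fun t =>
    (add_conv hψ.1 hθ.1 (isTame_zeroExt g) t).symm⟩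

theorem const_mul (hψ : IsStableKernel F ψ) (c : ℂ) : IsStableKernel F fun s => c * ψ s :=
  ⟨hψ.1.const_mul c, fun g hg => ((hψ.2 g hg).smul c).congr fun _ => (const_mul_conv c _).symm⟩

theorem sum {ι : Type*} (s : Finset ι) {ψ : ι → ℝ → ℂ} (hψ : ∀ i, IsStableKernel F (ψ i)) :
    IsStableKernel F fun r => ∑ i ∈ s, ψ i r :=
  ⟨integrable_finsetSum _ fun i _ => (hψ i).1, fun g hg =>
    (memSpace_sum s fun i _ => (hψ i).2 g hg).congr fun t =>
      (sum_conv s (fun i => (hψ i).1) (isTame_zeroExt g) t).symm⟩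

/-- By `‖(ψ - θ)*g‖∞ ≤ ‖ψ - θ‖₁ ‖g‖∞` and closedness of `F`, stable kernels form an `L¹`-closed set,
so a dense family suffices. -/
theorem of_approx (hF : IsClosed (F : Set (ℝ≥0 →ᵇ X))) (hψ : Integrable ψ)
    (happ : ∀ ε > 0, ∃ θ, IsStableKernel F θ ∧ ∫ s, ‖ψ s - θ s‖ ≤ ε) : IsStableKernel F ψ := by
  refine ⟨hψ, fun g hg => MemSpace.of_approx hF
    ((continuous_conv hψ (isTame_zeroExt g)).comp continuous_subtype_val) fun ε hε => ?_⟩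
  obtain ⟨θ, hθ, h1⟩ := happ (ε / (‖g‖ + 1)) (by positivity)
  refine ⟨_, hθ.2 g hg, fun t => ?_⟩
  rw [← sub_conv hψ hθ.1 (isTame_zeroExt g)]
  refine (norm_conv_le (hψ.sub hθ.1) (norm_zeroExt_le g) _).trans ?_
  calc (∫ s, ‖ψ s - θ s‖) * ‖g‖ ≤ ε / (‖g‖ + 1) * (‖g‖ + 1) := by gcongr; linarith
    _ = ε := by field_simp

end IsStableKernel

/-! ### Stability under all integrable kernels -/

theorem integrable_indicator_exp {a : ℝ} (ha : a < 0) :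
    Integrable ((Set.Ici (0 : ℝ)).indicator fun t => (Real.exp (a * t) : ℂ)) := by
  rw [integrable_indicator_iff measurableSet_Ici, integrableOn_Ici_iff_integrableOn_Ioi]
  exact (integrableOn_exp_mul_Ioi ha 0).ofReal

theorem conv_indicator_Ici_zeroExt (g : ℝ≥0 →ᵇ X) (e : ℝ → ℂ) (t : ℝ≥0) :
    conv ((Set.Ici (0 : ℝ)).indicator e) (zeroExt g) t
      = ∫ s in (0 : ℝ)..t, e ((t : ℝ) - s) • zeroExt g s := by
  rw [conv_swap, intervalIntegral.integral_of_le t.coe_nonneg, ← integral_Icc_eq_integral_Ioc,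
    ← integral_indicator measurableSet_Icc]
  refine integral_congr_ae (Eventually.of_forall fun s => ?_)
  rcases lt_or_ge s 0 with hs | hs
  · simp [Set.indicator, zeroExt_of_neg _ hs]
  · by_cases hst : s ≤ t <;> simp [Set.indicator, hs, hst]

theorem ConditionFPlus.isStableKernel_exp {F : Submodule ℂ (ℝ≥0 →ᵇ X)} (hF : ConditionFPlus F)
    {a : ℝ} (ha : a < 0) :
    IsStableKernel F ((Set.Ici (0 : ℝ)).indicator fun t => (Real.exp (a * t) : ℂ)) := by
  refine ⟨integrable_indicator_exp ha, fun g hg => (hF.backward g hg a (by simpa)).congr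
    fun t => ?_⟩
  rw [conv_indicator_Ici_zeroExt]
  simp

/-- Weierstrass approximation by exponential sums, with an exponential weight. -/
theorem exists_polynomial_exp_near {c : ℝ → ℝ} (hc : Continuous c) (hs : HasCompactSupport c)
    {δ : ℝ} (hδ : 0 < δ) : ∃ p : Polynomial ℝ, ∀ t, 0 ≤ t →
      |c t - Real.exp (-t) * p.eval (Real.exp (-t))| ≤ δ * Real.exp (-t) := by
  obtain ⟨R, hR⟩ := hs.isCompact.isBounded.subset_closedBall 0
  have hR' : ∀ t, R < t → c t = 0 := fun t ht => by
    by_contra h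
    have := hR (subset_tsupport _ h)
    rw [mem_closedBall_zero_iff, Real.norm_eq_abs] at this
    exact absurd ((le_abs_self t).trans this) ht.not_ge
  -- Under `x = e^{-t}` the half-line becomes `(0, 1]`. Dividing by `x` leaves a factor `e^{-t}` in
  -- the approximant and in the error, which makes both integrable. Near `x = 0` the quotient
  -- vanishes, as `c` has bounded support; at `0` itself division by zero gives the right value.
  have hq : ContinuousOn (fun x => c (-Real.log x) / x) (Set.Icc 0 1) := by
    intro x hx
    rcases eq_or_lt_of_le hx.1 with h0 | h0
    · subst h0
      refine (continuousWithinAt_const (b := (0 : ℝ))).congr_of_eventuallyEq ?_ (by simp)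
      refine mem_of_superset (inter_mem (mem_nhdsWithin_of_mem_nhds
        (gt_mem_nhds (Real.exp_pos (-R)))) self_mem_nhdsWithin) fun y hy => ?_
      simp only [Set.mem_ofPred_eq]
      rcases eq_or_lt_of_le hy.2.1 with hy0 | hy0
      · simp [← hy0]
      · have : Real.log y < -R := (Real.log_lt_iff_lt_exp hy0).2 hy.1
        rw [hR' _ (by linarith), zero_div]
    · refine ContinuousAt.continuousWithinAt ?_
      have : ContinuousAt Real.log x := Real.continuousAt_log h0.ne'
      exact (ContinuousAt.comp (f := fun x => -Real.log x) hc.continuousAt this.neg).div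
        continuousAt_id h0.ne'
  obtain ⟨p, hp⟩ := exists_polynomial_near_of_continuousOn 0 1 _ hq δ hδ
  refine ⟨p, fun t ht => ?_⟩
  have he := Real.exp_pos (-t)
  have h1 := (hp (Real.exp (-t)) ⟨he.le, by simpa using ht⟩).le
  rw [Real.log_exp, neg_neg] at h1
  have : c t - Real.exp (-t) * p.eval (Real.exp (-t))
      = -(p.eval (Real.exp (-t)) - c t / Real.exp (-t)) * Real.exp (-t) := by
    field_simp
    ring
  rw [this, abs_mul, abs_neg, abs_of_pos he]
  gcongr

/-- Sums of decaying exponentials are dense in `L¹(ℝ⁺)`: approximate first by a continuous compactly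
supported function, then by Weierstrass. -/
theorem ConditionFPlus.isStableKernel_indicator_ofReal {F : Submodule ℂ (ℝ≥0 →ᵇ X)}
    (hF : ConditionFPlus F) {ψ : ℝ → ℝ} (hψ : Integrable ψ) :
    IsStableKernel F ((Set.Ici (0 : ℝ)).indicator fun t => (ψ t : ℂ)) := by
  refine IsStableKernel.of_approx hF.isClosed (hψ.ofReal.indicator measurableSet_Ici)
    fun ε hε => ?_
  obtain ⟨c, hcs, hc1, hcc, hci⟩ := hψ.exists_hasCompactSupport_integral_sub_le (half_pos hε)
  obtain ⟨p, hp⟩ := exists_polynomial_exp_near hcc hcs (half_pos hε)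
  -- The exponent is `k + 1` because the polynomial in `e^{-t}` carries an extra factor `e^{-t}`;
  -- thus `k = 0` also decays.
  let e : ℕ → ℝ → ℂ := fun k =>
    (Set.Ici (0 : ℝ)).indicator fun t => (Real.exp (-(k + 1 : ℝ) * t) : ℂ)
  have he : ∀ k, IsStableKernel F (e k) := fun k => hF.isStableKernel_exp (by linarith)
  have hsum := IsStableKernel.sum (Finset.range (p.natDegree + 1))
    fun k => (he k).const_mul (p.coeff k : ℂ)
  refine ⟨_, hsum, ?_⟩
  have hval : ∀ t, 0 ≤ t → ∑ k ∈ Finset.range (p.natDegree + 1), (p.coeff k : ℂ) * e k t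
      = ((Real.exp (-t) * p.eval (Real.exp (-t)) : ℝ) : ℂ) := by
    intro t ht
    rw [Polynomial.eval_eq_sum_range, Finset.mul_sum, Complex.ofReal_sum]
    refine Finset.sum_congr rfl fun k _ => ?_
    simp only [e, Set.indicator_of_mem (Set.mem_Ici.2 ht)]
    rw [← Complex.ofReal_mul, ← Real.exp_nat_mul]
    congr 1
    rw [mul_left_comm, ← Real.exp_add]
    ring_nf
  have hbound : ∀ t, ‖(Set.Ici (0 : ℝ)).indicator (fun t => (ψ t : ℂ)) t
      - ∑ k ∈ Finset.range (p.natDegree + 1), (p.coeff k : ℂ) * e k t‖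
      ≤ ‖ψ t - c t‖ + ε / 2 * (Set.Ici (0 : ℝ)).indicator (fun t => Real.exp (-t)) t := by
    intro t
    rcases lt_or_ge t 0 with ht | ht
    · have : ∀ k, e k t = 0 := fun k => Set.indicator_of_notMem (by simpa using ht) _
      simp [Set.indicator, ht.not_ge, this]
    · rw [hval t ht, Set.indicator_of_mem (Set.mem_Ici.2 ht),
        Set.indicator_of_mem (Set.mem_Ici.2 ht), ← Complex.ofReal_sub, Complex.norm_real]
      calc ‖ψ t - Real.exp (-t) * p.eval (Real.exp (-t))‖
          = ‖(ψ t - c t) + (c t - Real.exp (-t) * p.eval (Real.exp (-t)))‖ := by congr 1; ring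
        _ ≤ _ := (norm_add_le _ _).trans (add_le_add_right (hp t ht) _)
  have hi : Integrable ((Set.Ici (0 : ℝ)).indicator fun t => Real.exp (-t)) := by
    rw [integrable_indicator_iff measurableSet_Ici, integrableOn_Ici_iff_integrableOn_Ioi]
    exact integrableOn_exp_neg_Ioi 0
  have hi1 : ∫ t, (Set.Ici (0 : ℝ)).indicator (fun t => Real.exp (-t)) t = 1 := by
    rw [integral_indicator measurableSet_Ici, integral_Ici_eq_integral_Ioi,
      integral_exp_neg_Ioi_zero]
  calc _ ≤ ∫ t, ‖ψ t - c t‖ + ε / 2 * (Set.Ici (0 : ℝ)).indicator (fun t => Real.exp (-t)) t :=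
        integral_mono ((hψ.ofReal.indicator measurableSet_Ici).sub hsum.1).norm
          ((hψ.sub hci).norm.add (hi.const_mul _)) hbound
    _ = (∫ t, ‖ψ t - c t‖) + ε / 2 := by
        have hadd := integral_add (hψ.sub hci).norm (hi.const_mul (ε / 2))
        rw [integral_const_mul, hi1, mul_one] at hadd
        exact hadd
    _ ≤ ε := by linarith

/-- Cut the kernel at the origin: condition (v) handles the negative part, exponential approximation
of real and imaginary parts the other. -/
theorem ConditionFPlusPlus.isStableKernel {F : Submodule ℂ (ℝ≥0 →ᵇ X)}
    (hF : ConditionFPlusPlus F) {ψ : ℝ → ℂ} (hψ : Integrable ψ) : IsStableKernel F ψ := by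
  have hneg : IsStableKernel F ((Set.Iio (0 : ℝ)).indicator ψ) := by
    refine ⟨hψ.indicator measurableSet_Iio, fun g hg => ?_⟩
    refine (hF.convolution _ (hψ.indicator measurableSet_Iio) (fun t ht => ?_) g hg).congr
      fun t => (conv_swap _ _ _).symm
    exact Set.indicator_of_notMem (by simpa using ht.le) _
  have hpos := (hF.isStableKernel_indicator_ofReal hψ.re).add
    ((hF.isStableKernel_indicator_ofReal hψ.im).const_mul Complex.I)
  convert hneg.add hpos using 2 with t
  rcases lt_or_ge t 0 with ht | ht
  · simp [Set.indicator, ht, ht.not_ge]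
  · simp only [Set.indicator, Set.mem_Iio, ht.not_gt, Set.mem_Ici, ht, if_true, if_false, zero_add]
    rw [mul_comm]
    exact (Complex.re_add_im _).symm

/-- If `h` restricts to an element of `F` on the half-line, so does its convolution with an
integrable kernel. -/
theorem ConditionFPlusPlus.memSpace_conv {F : Submodule ℂ (ℝ≥0 →ᵇ X)}
    (hF : ConditionFPlusPlus F) {ψ : ℝ → ℂ} (hψ : Integrable ψ) {h : ℝ → X} (hh : IsTame h)
    (hm : MemSpace (fun t : ℝ≥0 => h t) F) : MemSpace (fun t : ℝ≥0 => conv ψ h t) F := by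
  obtain ⟨G, hG, hGh⟩ := hm
  -- This difference vanishes on the half-line, so its convolution tends to zero and lies in `C₀ ⊆
  -- F`: the past of `h` is irrelevant.
  have hd := hh.sub (isTame_zeroExt G)
  have ht := isTame_conv hψ hd
  obtain ⟨C, hC⟩ := ht.bounded
  have h0 : Tendsto (fun t => h t - zeroExt G t) atTop (𝓝 0) := by
    refine tendsto_const_nhds.congr' ?_
    filter_upwards [eventually_ge_atTop 0] with t ht
    lift t to ℝ≥0 using ht
    simp [hGh]
  have h1 := hF.memSpace_of_tendsto (g := fun t : ℝ≥0 => conv ψ (fun t => h t - zeroExt G t) t)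
    ((continuous_conv hψ hd).comp continuous_subtype_val) (fun t => hC t)
    ((tendsto_conv hψ hd h0).comp (NNReal.tendsto_coe_atTop.2 tendsto_id))
  refine (h1.add ((hF.isStableKernel hψ).2 G hG)).congr fun t => ?_
  rw [conv_sub hψ hh (isTame_zeroExt G), sub_add_cancel]

end EvolEq

open scoped FourierTransform SchwartzMap

namespace EvolEq

/-! ### Kernels with prescribed Fourier transform -/

theorem fourier_sub_apply {p q : ℝ → ℂ} (hp : Integrable p) (hq : Integrable q) (ξ : ℝ) :
    𝓕 (fun t => p t - q t) ξ = 𝓕 p ξ - 𝓕 q ξ := by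
  simp only [Real.fourier_real_eq, smul_sub]
  exact integral_sub (by simpa [mul_comm] using (Real.fourierIntegral_convergent_iff ξ).2 hp)
    (by simpa [mul_comm] using (Real.fourierIntegral_convergent_iff ξ).2 hq)

theorem fourier_const_mul_apply (c : ℂ) (p : ℝ → ℂ) (ξ : ℝ) :
    𝓕 (fun t => c * p t) ξ = c * 𝓕 p ξ := by
  simp only [Real.fourier_real_eq]
  rw [← integral_const_mul]
  simp only [Circle.smul_def, smul_eq_mul, mul_left_comm]

/-- The difference has zero, hence integrable, transform; Fourier inversion for continuous functions
applies to it. -/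
theorem eq_of_fourier_eq {p q : ℝ → ℂ} (hp : Integrable p) (hq : Integrable q)
    (hpc : Continuous p) (hqc : Continuous q) (h : ∀ ξ, 𝓕 p ξ = 𝓕 q ξ) : p = q := by
  have h0 : 𝓕 (p - q) = fun _ => (0 : ℂ) := by
    ext ξ
    exact (fourier_sub_apply hp hq ξ).trans (by rw [h, sub_self])
  have h1 := (hpc.sub hqc).fourierInv_fourier_eq (hp.sub hq)
    (by rw [h0]; exact integrable_zero _ _ _)
  rw [h0] at h1
  ext t
  have h2 := congrFun h1 t
  simp only [Real.fourierInv_eq, smul_zero, integral_zero, Pi.sub_apply] at h2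
  exact sub_eq_zero.1 h2.symm

theorem fourier_conv {p q : ℝ → ℂ} (hp : Integrable p) (hq : Integrable q) (ξ : ℝ) :
    𝓕 (conv p q) ξ = 𝓕 p ξ * 𝓕 q ξ := by
  rw [conv_eq_convolution]
  exact Real.fourier_smul_convolution_eq hp hq ξ

/-- Dilation and modulation of a kernel, normalised to preserve the `L¹` norm. -/
noncomputable def dilate (g : ℝ → ℂ) (a b t : ℝ) : ℂ :=
  Complex.exp (2 * Real.pi * Complex.I * b * t) * (a * g (a * t))

section dilate

variable {g : ℝ → ℂ} {a : ℝ}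

theorem norm_exp_two_pi_mul (b t : ℝ) : ‖Complex.exp (2 * Real.pi * Complex.I * b * t)‖ = 1 := by
  rw [show (2 * Real.pi * Complex.I * b * t : ℂ) = ((2 * Real.pi * b * t : ℝ) : ℂ) * Complex.I by
    push_cast; ring, Complex.norm_exp_ofReal_mul_I]

theorem norm_dilate (ha : 0 < a) (b t : ℝ) : ‖dilate g a b t‖ = a * ‖g (a * t)‖ := by
  rw [dilate, norm_mul, norm_exp_two_pi_mul, one_mul, norm_mul, Complex.norm_real,
    Real.norm_of_nonneg ha.le]

theorem integrable_dilate (hg : Integrable g) (ha : 0 < a) (b : ℝ) :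
    Integrable (dilate g a b) := by
  refine ((hg.comp_mul_left' ha.ne').const_mul (a : ℂ)).bdd_mul (c := 1)
    (Continuous.aestronglyMeasurable (by fun_prop)) (Eventually.of_forall fun t => ?_)
  rw [norm_exp_two_pi_mul]

theorem integral_norm_dilate (ha : 0 < a) (b : ℝ) : ∫ t, ‖dilate g a b t‖ = ∫ t, ‖g t‖ := by
  simp only [norm_dilate ha, integral_const_mul]
  rw [Measure.integral_comp_mul_left (fun t => ‖g t‖), abs_of_pos (inv_pos.2 ha), smul_eq_mul,
    mul_inv_cancel_left₀ ha.ne']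

theorem continuous_dilate (hg : Continuous g) (b : ℝ) : Continuous (dilate g a b) := by
  unfold dilate
  fun_prop

theorem fourier_dilate (ha : 0 < a) (b ξ : ℝ) : 𝓕 (dilate g a b) ξ = 𝓕 g ((ξ - b) / a) := by
  rw [Real.fourier_real_eq_integral_exp_smul, Real.fourier_real_eq_integral_exp_smul]
  have h := Measure.integral_comp_mul_left
    (fun t : ℝ => Complex.exp (↑(-2 * Real.pi * t * ((ξ - b) / a)) * Complex.I) • g t) a
  rw [abs_of_pos (inv_pos.2 ha)] at h
  -- Both sides are scaled by `a⁻¹` so that the right one is the output of the substitution `t ↦ a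
  -- t`.
  rw [← smul_right_injective _ (inv_pos.2 ha).ne' |>.eq_iff, ← h, ← integral_smul]
  refine integral_congr_ae (Eventually.of_forall fun t => ?_)
  have ha' : (a : ℂ) ≠ 0 := by exact_mod_cast ha.ne'
  simp only [dilate, smul_eq_mul, Complex.real_smul]
  rw [← mul_assoc (Complex.exp _) (Complex.exp _), ← Complex.exp_add]
  have : (↑(-2 * Real.pi * t * ξ) * Complex.I + 2 * Real.pi * Complex.I * b * t : ℂ)
      = ↑(-2 * Real.pi * (a * t) * ((ξ - b) / a)) * Complex.I := by
    push_cast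
    field_simp
    ring
  rw [this]
  push_cast
  field_simp

end dilate

/-- The inverse Fourier transform of a smooth compactly supported function. -/
theorem exists_schwartz_fourier_eq {χ : ℝ → ℂ} (hs : HasCompactSupport χ)
    (hχ : ContDiff ℝ (⊤ : ℕ∞) χ) : ∃ θ : 𝓢(ℝ, ℂ), ∀ ξ, 𝓕 (θ : ℝ → ℂ) ξ = χ ξ := by
  refine ⟨𝓕⁻ (hs.toSchwartzMap hχ), fun ξ => ?_⟩
  rw [← SchwartzMap.fourier_coe, FourierTransform.fourier_fourierInv_eq]
  rfl

/-- Serves twice: the plateau gives the Bernstein kernel, and rescaling gives a band-limited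
approximate identity. -/
theorem exists_schwartz_fourier_eq_one : ∃ m : 𝓢(ℝ, ℂ),
    ContDiff ℝ (⊤ : ℕ∞) (𝓕 (m : ℝ → ℂ)) ∧ HasCompactSupport (𝓕 (m : ℝ → ℂ)) ∧
      ∀ ξ, |ξ| ≤ 1 → 𝓕 (m : ℝ → ℂ) ξ = 1 := by
  let b : ContDiffBump (0 : ℝ) := ⟨1, 2, one_pos, one_lt_two⟩
  have hb : ContDiff ℝ (⊤ : ℕ∞) fun ξ => (b ξ : ℂ) := Complex.ofRealCLM.contDiff.comp b.contDiff
  have hs : HasCompactSupport fun ξ => (b ξ : ℂ) :=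
    b.hasCompactSupport.comp_left (g := fun x : ℝ => (x : ℂ)) Complex.ofReal_zero
  obtain ⟨m, hm⟩ := exists_schwartz_fourier_eq hs hb
  have hm' : 𝓕 (m : ℝ → ℂ) = fun ξ => (b ξ : ℂ) := funext hm
  refine ⟨m, hm' ▸ hb, hm' ▸ hs, fun ξ hξ => ?_⟩
  rw [hm, b.one_of_mem_closedBall (by simpa using hξ), Complex.ofReal_one]

theorem integrable_deriv_schwartz (θ : 𝓢(ℝ, ℂ)) : Integrable (deriv θ) :=
  (SchwartzMap.derivCLM ℝ ℂ θ).integrable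

theorem continuous_deriv_schwartz (θ : 𝓢(ℝ, ℂ)) : Continuous (deriv θ) :=
  (SchwartzMap.derivCLM ℝ ℂ θ).continuous

theorem fourier_deriv_schwartz (θ : 𝓢(ℝ, ℂ)) (ξ : ℝ) :
    𝓕 (deriv θ) ξ = 2 * Real.pi * Complex.I * ξ * 𝓕 (θ : ℝ → ℂ) ξ := by
  rw [Real.fourier_deriv θ.integrable θ.differentiable (integrable_deriv_schwartz θ)]
  rfl

/-- A Bernstein-type factorisation: on kernels with Fourier transform supported near `b`, the
operator `θ ↦ θ' - 2πib θ` is convolution with a kernel of small norm. -/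
theorem exists_bernstein_kernel : ∃ C : ℝ, 0 ≤ C ∧ ∀ (b a : ℝ), 0 < a → ∃ k : ℝ → ℂ,
    Integrable k ∧ (∫ t, ‖k t‖) = a * C ∧ ∀ θ : 𝓢(ℝ, ℂ),
      (∀ ξ, a < |ξ - b| → 𝓕 (θ : ℝ → ℂ) ξ = 0) →
        conv k θ = fun t => deriv θ t - 2 * Real.pi * Complex.I * b * θ t := by
  obtain ⟨m, -, -, hm⟩ := exists_schwartz_fourier_eq_one
  have hmi := integrable_deriv_schwartz m
  refine ⟨∫ t, ‖deriv m t‖, integral_nonneg fun _ => norm_nonneg _, fun b a ha => ?_⟩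
  have hk := (integrable_dilate hmi ha b).const_mul (a : ℂ)
  -- The transform is `2πi(ξ - b) m̂((ξ - b)/a)`, which equals the symbol `2πi(ξ - b)` for `|ξ - b|
  -- ≤ a`, where `θ̂` lives.
  refine ⟨fun t => a * dilate (deriv m) a b t, hk, ?_, fun θ hθ => ?_⟩
  · simp only [norm_mul, Complex.norm_real, Real.norm_of_nonneg ha.le]
    rw [integral_const_mul, integral_norm_dilate ha]
  · have hθi : Integrable fun t => 2 * Real.pi * Complex.I * b * θ t := θ.integrable.const_mul _
    have hθt : IsTame θ := IsTame.of_continuous θ.continuous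
      fun t => θ.toBoundedContinuousFunction.norm_coe_le_norm t
    refine eq_of_fourier_eq (integrable_conv hk θ.integrable)
      ((integrable_deriv_schwartz θ).sub hθi) (continuous_conv hk hθt)
      ((continuous_deriv_schwartz θ).sub (continuous_const.mul θ.continuous)) fun ξ => ?_
    rw [fourier_conv hk θ.integrable, fourier_const_mul_apply, fourier_dilate ha,
      fourier_sub_apply (integrable_deriv_schwartz θ) hθi, fourier_const_mul_apply,
      fourier_deriv_schwartz, fourier_deriv_schwartz]
    by_cases hξ : a < |ξ - b|
    · rw [hθ ξ hξ]
      simp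
    · rw [hm ((ξ - b) / a) (by rw [abs_div, abs_of_pos ha, div_le_one ha]; exact not_lt.1 hξ)]
      have ha' : (a : ℂ) ≠ 0 := by exact_mod_cast ha.ne'
      push_cast
      field_simp

end EvolEq

namespace EvolEq

variable {X : Type*} [NormedAddCommGroup X]

/-! ### Mild solutions near a point of the resolvent set -/

theorem intervalIntegrable_zeroExt (g : ℝ≥0 →ᵇ X) (a b : ℝ) :
    IntervalIntegrable (zeroExt g) volume a b :=
  (intervalIntegrable_const (c := ‖g‖)).mono_fun'
    (isTame_zeroExt g).aestronglyMeasurable.restrict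
    (Eventually.of_forall fun t => norm_zeroExt_le g t)

variable [NormedSpace ℂ X]

theorem tendsto_schwartz_atBot (θ : 𝓢(ℝ, ℂ)) : Tendsto θ atBot (𝓝 0) :=
  θ.toZeroAtInfty.zero_at_infty'.mono_left atBot_le_cocompact

theorem conv_eq_integral_Ioi {ψ : ℝ → ℂ} {h : ℝ → X} (h0 : ∀ s < 0, h s = 0) (t : ℝ) :
    conv ψ h t = ∫ s in Set.Ioi 0, ψ (t - s) • h s := by
  rw [conv_swap, ← integral_Ici_eq_integral_Ioi, setIntegral_eq_integral_of_forall_compl_eq_zero]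
  intro s hs
  rw [h0 s (by simpa using hs), smul_zero]

theorem integrable_smul_sub {ψ : ℝ → ℂ} {h : ℝ → X} (hψ : Integrable ψ) (hh : IsTame h) (t : ℝ) :
    Integrable fun s => ψ (t - s) • h s := by
  simpa using (integrable_smul_comp_sub hψ hh t).comp_sub_left t

/-- Integration by parts on the half-line. -/
theorem conv_deriv_eq [CompleteSpace X] (θ : 𝓢(ℝ, ℂ)) {w h y : ℝ → X} (hh : IsTame h)
    (hy : IsTame y) (hh0 : ∀ s < 0, h s = 0) (hy0 : ∀ s < 0, y s = 0) (hwh : ∀ s, 0 ≤ s → w s = h s)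
    (hw : Continuous w) (hwy : ∀ s, 0 < s → HasDerivAt w (y s) s) (t : ℝ) :
    conv (deriv θ) h t = conv θ y t + θ t • w 0 := by
  have i1 := integrable_smul_sub (integrable_deriv_schwartz θ) hh t
  have i2 := integrable_smul_sub θ.integrable hy t
  have hd : ∀ s ∈ Set.Ioi (0 : ℝ), HasDerivAt (fun s => θ (t - s) • w s)
      (θ (t - s) • y s - deriv θ (t - s) • h s) s := by
    intro s hs
    have h1 : HasDerivAt (fun s => θ (t - s)) (-deriv θ (t - s)) s := by
      simpa using (θ.differentiableAt (x := t - s)).hasDerivAt.comp_const_sub t s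
    have h2 := h1.smul (hwy s hs)
    rwa [hwh s (le_of_lt hs), neg_smul, ← sub_eq_add_neg] at h2
  have hlim : Tendsto (fun s => θ (t - s) • w s) atTop (𝓝 0) := by
    obtain ⟨C, hC⟩ := hh.bounded
    have h1 : Tendsto (fun s => θ (t - s)) atTop (𝓝 0) :=
      (tendsto_schwartz_atBot θ).comp (
        (tendsto_atBot_add_const_left atTop t tendsto_neg_atTop_atBot).congr fun s =>
          (sub_eq_add_neg t s).symm)
    refine squeeze_zero_norm' (a := fun s => ‖θ (t - s)‖ * C) ?_ (by
      simpa using h1.norm.mul_const C)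
    filter_upwards [eventually_ge_atTop 0] with s hs
    rw [norm_smul, hwh s hs]
    gcongr
    exact hC s
  have hc : Continuous fun s => θ (t - s) • w s :=
    (θ.continuous.comp (continuous_const.sub continuous_id)).smul hw
  -- The total derivative of `θ(t - s) w(s)` integrates to `-θ(t) w(0)`, the source of the boundary
  -- term.
  have key := integral_Ioi_of_hasDerivAt_of_tendsto
    (hc.continuousWithinAt (x := (0 : ℝ)) (s := Set.Ici 0)) hd (i2.sub i1).integrableOn hlim
  rw [integral_sub i2.integrableOn i1.integrableOn, ← conv_eq_integral_Ioi hh0,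
    ← conv_eq_integral_Ioi hy0] at key
  rw [sub_zero, sub_eq_iff_eq_add] at key
  rw [key]
  abel

theorem hasDerivAt_integral_zeroExt [CompleteSpace X] (g : ℝ≥0 →ᵇ X) {s : ℝ} (hs : 0 < s) :
    HasDerivAt (fun t : ℝ => ∫ r in (0 : ℝ)..t, zeroExt g r) (zeroExt g s) s :=
  intervalIntegral.integral_hasDerivAt_right (intervalIntegrable_zeroExt g _ _)
    ((isTame_zeroExt g).aestronglyMeasurable.stronglyMeasurableAtFilter)
    ((isTame_zeroExt g).continuousAt s hs.ne')

/-- The convolution of a mild solution with a Schwartz kernel, in terms of the resolvent. -/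
theorem IsMildSolution.conv_eq [CompleteSpace X] {A : X →ₗ.[ℂ] X} {f u : ℝ≥0 →ᵇ X}
    (hu : IsMildSolution A f u) {z : ℂ} {R : X →L[ℂ] X}
    (hR : ∀ x : A.domain, R (z • (x : X) - A x) = x) (θ : 𝓢(ℝ, ℂ)) (t : ℝ) :
    conv θ (zeroExt u) t = R (z • conv θ (zeroExt u) t - conv (deriv θ) (zeroExt u) t
      + conv θ (zeroExt f) t + θ t • u 0) := by
  have tu := isTame_zeroExt u
  have tf := isTame_zeroExt f
  set U : ℝ → X := fun t => ∫ r in (0 : ℝ)..t, zeroExt u r with hU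
  set V : ℝ → X := fun t => ∫ r in (0 : ℝ)..t, zeroExt f r with hV
  have hUc : Continuous U :=
    intervalIntegral.continuous_primitive (intervalIntegrable_zeroExt u) 0
  have hVc : Continuous V :=
    intervalIntegral.continuous_primitive (intervalIntegrable_zeroExt f) 0
  -- Applying `R` to the integrated equation and using `R A = z R - 1` on the domain shows that `R
  -- u` equals this `w` on the half-line. So `R u` is differentiable there although `u` need not be.
  have h1 := conv_deriv_eq θ (w := fun s => R (u 0) + (z • R (U s) - U s + R (V s)))
    (h := fun s => R (zeroExt u s))
    (y := fun s => z • R (zeroExt u s) - zeroExt u s + R (zeroExt f s))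
    (tu.clm_comp R) ((((tu.clm_comp R).const_smul z).sub tu).add (tf.clm_comp R))
    (fun s hs => by simp [zeroExt_of_neg _ hs]) (fun s hs => by simp [zeroExt_of_neg _ hs])
    ?_ (by fun_prop) ?_ t
  · rw [conv_add θ.integrable (((tu.clm_comp R).const_smul z).sub tu) (tf.clm_comp R),
      conv_sub θ.integrable ((tu.clm_comp R).const_smul z) tu, conv_const_smul,
      ← clm_conv R θ.integrable tu, ← clm_conv R θ.integrable tf,
      ← clm_conv R (integrable_deriv_schwartz θ) tu] at h1
    simp only [hU, hV, intervalIntegral.integral_same, map_zero, smul_zero, sub_zero,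
      add_zero] at h1
    rw [map_add, map_add, map_sub, map_smul, map_smul, h1]
    abel
  · intro s hs
    lift s to ℝ≥0 using hs
    obtain ⟨hd, he⟩ := hu s
    have h2 := hR ⟨_, hd⟩
    rw [map_sub, map_smul] at h2
    have h3 := congrArg R he
    rw [map_sub, map_add] at h3
    have h4 : U s = z • R (U s) - R (A ⟨U s, hd⟩) := h2.symm
    have h5 : R (u s) - R (u 0) = R (A ⟨U s, hd⟩) + R (V s) := h3
    rw [eq_sub_iff_add_eq] at h4
    rw [sub_eq_iff_eq_add'] at h5
    rw [zeroExt_coe, h5, ← h4]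
    abel
  · intro s hs
    have hdU := hasDerivAt_integral_zeroExt u hs
    have hdV := hasDerivAt_integral_zeroExt f hs
    have e1 : HasDerivAt (fun s => R (U s)) (R (zeroExt u s)) s :=
      (R.restrictScalars ℝ).hasFDerivAt.comp_hasDerivAt s hdU
    have e2 : HasDerivAt (fun s => R (V s)) (R (zeroExt f s)) s :=
      (R.restrictScalars ℝ).hasFDerivAt.comp_hasDerivAt s hdV
    exact (((e1.const_smul z).sub hdU).add e2).const_add _

end EvolEq

namespace EvolEq

variable {X : Type*} [NormedAddCommGroup X] [NormedSpace ℂ X]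

theorem tendsto_schwartz_atTop (θ : 𝓢(ℝ, ℂ)) : Tendsto θ atTop (𝓝 0) :=
  θ.toZeroAtInfty.zero_at_infty'.mono_left atTop_le_cocompact

theorem ConditionFPlus.memSpace_schwartz_smul {F : Submodule ℂ (ℝ≥0 →ᵇ X)}
    (hF : ConditionFPlus F) (θ : 𝓢(ℝ, ℂ)) (x : X) : MemSpace (fun t : ℝ≥0 => θ t • x) F := by
  have h0 : Tendsto (fun t : ℝ≥0 => θ t) atTop (𝓝 0) :=
    (tendsto_schwartz_atTop θ).comp (NNReal.tendsto_coe_atTop.2 tendsto_id)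
  refine hF.memSpace_of_tendsto (C := ‖θ.toBoundedContinuousFunction‖ * ‖x‖)
    ((θ.continuous.comp continuous_subtype_val).smul continuous_const) (fun t => ?_)
    (by simpa using h0.smul_const x)
  rw [norm_smul]
  gcongr
  exact θ.toBoundedContinuousFunction.norm_coe_le_norm t

/-- A mild solution, filtered to frequencies near a point of the resolvent set, belongs to `F`. -/
theorem IsMildSolution.exists_memSpace_conv [CompleteSpace X] {A : X →ₗ.[ℂ] X} {f u : ℝ≥0 →ᵇ X}
    (hu : IsMildSolution A f u) {F : Submodule ℂ (ℝ≥0 →ᵇ X)} (hF : ConditionFPlusPlus F)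
    (hf : f ∈ F) {b : ℝ} (hb : (2 * Real.pi * Complex.I * b : ℂ) ∈ resolventSet A) :
    ∃ a > 0, ∀ θ : 𝓢(ℝ, ℂ), (∀ ξ, a < |ξ - b| → 𝓕 (θ : ℝ → ℂ) ξ = 0) →
      MemSpace (fun t : ℝ≥0 => conv θ (zeroExt u) t) F := by
  obtain ⟨R, -, hR⟩ := hb
  obtain ⟨C, hC0, hC⟩ := exists_bernstein_kernel
  have tu := isTame_zeroExt u
  -- This width gives `‖R‖ ‖k‖₁ ≤ 1/2`; the `+ 1` avoids division by zero.
  refine ⟨(2 * (‖R‖ * C + 1))⁻¹, by positivity, fun θ hθ => ?_⟩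
  obtain ⟨k, hki, hkn, hk⟩ := hC b _ (by positivity : (0 : ℝ) < (2 * (‖R‖ * C + 1))⁻¹)
  have hkθ := hk θ hθ
  set h := conv θ (zeroExt u) with hh
  have th : IsTame h := isTame_conv θ.integrable tu
  have hc : Continuous h := continuous_conv θ.integrable tu
  have heq : ∀ t, h t = R (-conv k h t + conv θ (zeroExt f) t + θ t • u 0) := by
    intro t
    have h1 := hu.conv_eq hR θ t
    have h2 : conv k h t = conv (deriv θ) (zeroExt u) t
        - (2 * Real.pi * Complex.I * b : ℂ) • h t := by
      rw [hh, ← conv_assoc hki θ.integrable tu, hkθ,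
        sub_conv (integrable_deriv_schwartz θ) (θ.integrable.const_mul _) tu, const_mul_conv]
    rw [h2, neg_sub]
    exact h1
  -- Substituting an approximant from `F` into the fixed-point equation halves the error and stays
  -- in `F`.
  have hstep : ∀ ε, (∃ g, MemSpace g F ∧ ∀ t : ℝ≥0, ‖h t - g t‖ ≤ ε) →
      ∃ g, MemSpace g F ∧ ∀ t : ℝ≥0, ‖h t - g t‖ ≤ ε / 2 := by
    rintro ε ⟨g, ⟨G, hG, hGg⟩, hε⟩
    have hε0 : 0 ≤ ε := (norm_nonneg _).trans (hε 0)
    have td := (th.sub (isTame_zeroExt G)).indicator_Ici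
    -- The error is cut off on the negative axis, where no bound by `ε` is known; `h - e` still
    -- agrees with `G` on the half-line.
    set e : ℝ → X := (Set.Ici 0).indicator fun t => h t - zeroExt G t with he
    have hee : ∀ t : ℝ≥0, e t = h t - G t := fun t => by
      rw [he, Set.indicator_of_mem (Set.mem_Ici.2 t.coe_nonneg), zeroExt_coe]
    have heε : ∀ t, ‖e t‖ ≤ ε := fun t => by
      rcases lt_or_ge t 0 with ht | ht
      · rw [he, Set.indicator_of_notMem (by simpa using ht), norm_zero]
        exact hε0
      · lift t to ℝ≥0 using ht
        rw [hee, hGg]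
        exact hε t
    have m1 : MemSpace (fun t : ℝ≥0 => conv k (fun s => h s - e s) t) F :=
      hF.memSpace_conv hki (th.sub td) ⟨G, hG, fun t => by simp only [hee, sub_sub_cancel]⟩
    have m2 := (((m1.smul (-1)).add ((hF.isStableKernel θ.integrable).2 f hf)).add
      (hF.memSpace_schwartz_smul θ (u 0)))
    obtain ⟨G₂, hG₂, hGG⟩ := m2
    refine ⟨_, hF.comp_left R G₂ hG₂, fun t => ?_⟩
    rw [hGG, heq t, ← map_sub]
    beta_reduce
    rw [conv_sub hki th td]
    have : -conv k h t + conv θ (zeroExt f) t + θ t • u 0 - ((-1 : ℂ) • (conv k h t - conv k e t)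
        + conv θ (zeroExt f) t + θ t • u 0) = -conv k e t := by
      rw [neg_one_smul]
      abel
    rw [this]
    calc ‖R (-conv k e t)‖ ≤ ‖R‖ * (((2 * (‖R‖ * C + 1))⁻¹ * C) * ε) := by
          refine R.le_opNorm_of_le ?_
          rw [norm_neg, ← hkn]
          exact norm_conv_le hki heε t
      _ = (‖R‖ * C) / (‖R‖ * C + 1) * (ε / 2) := by
          have : ‖R‖ * C + 1 ≠ 0 := by positivity
          field_simp
      _ ≤ 1 * (ε / 2) := by
          gcongr
          rw [div_le_one (by positivity)]
          linarith
      _ = ε / 2 := one_mul _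
  obtain ⟨M, hM⟩ := th.bounded
  have hiter : ∀ n : ℕ, ∃ g, MemSpace g F ∧ ∀ t : ℝ≥0, ‖h t - g t‖ ≤ M / 2 ^ n := by
    intro n
    induction n with
    | zero => exact ⟨0, ⟨0, F.zero_mem, fun _ => rfl⟩, fun t => by simpa using hM t⟩
    | succ n ih =>
      obtain ⟨g, hg, hgt⟩ := hstep _ ih
      exact ⟨g, hg, fun t => (hgt t).trans_eq (by rw [pow_succ, div_div])⟩
  refine MemSpace.of_approx hF.isClosed (hc.comp continuous_subtype_val) fun ε hε => ?_
  have hlim : Tendsto (fun n : ℕ => M / 2 ^ n) atTop (𝓝 0) := by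
    simpa [div_eq_mul_inv] using
      (tendsto_inv_atTop_zero.comp (tendsto_pow_atTop_atTop_of_one_lt
        (one_lt_two : (1 : ℝ) < 2))).const_mul M
  obtain ⟨n, hn⟩ := ((tendsto_order.1 hlim).2 ε hε).exists
  obtain ⟨g, hg, hgt⟩ := hiter n
  exact ⟨g, hg, fun t => (hgt t).trans hn.le⟩

end EvolEq

open scoped Manifold ContDiff

namespace EvolEq

variable {X : Type*} [NormedAddCommGroup X] [NormedSpace ℂ X]

/-! ### Synthesis of the local results -/

theorem fourier_sum_apply {ι : Type*} (s : Finset ι) {p : ι → ℝ → ℂ} (hp : ∀ i, Integrable (p i))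
    (ξ : ℝ) : 𝓕 (fun t => ∑ i ∈ s, p i t) ξ = ∑ i ∈ s, 𝓕 (p i) ξ := by
  simp only [Real.fourier_real_eq, Finset.smul_sum]
  exact integral_finsetSum _ fun i _ => by
    simpa [mul_comm] using (Real.fourierIntegral_convergent_iff ξ).2 (hp i)

/-- If the Fourier transform of `ψ` vanishes near the imaginary spectrum, then a band-limited
truncation of `ψ` filters a mild solution into `F`. -/
theorem IsMildSolution.memSpace_conv_conv [CompleteSpace X] {A : X →ₗ.[ℂ] X} {f u : ℝ≥0 →ᵇ X}
    (hu : IsMildSolution A f u) {F : Submodule ℂ (ℝ≥0 →ᵇ X)} (hF : ConditionFPlusPlus F)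
    (hf : f ∈ F) {ψ K : ℝ → ℂ} (hψ : Integrable ψ) (hK : Integrable K) (hKt : IsTame K)
    (hKd : ContDiff ℝ ∞ (𝓕 K)) (hKs : HasCompactSupport (𝓕 K)) {U : Set ℝ} (hU : IsOpen U)
    (hUψ : ∀ ξ ∈ U, 𝓕 ψ ξ = 0)
    (hUA : ∀ b ∉ U, (2 * Real.pi * Complex.I * b : ℂ) ∈ resolventSet A) :
    MemSpace (fun t : ℝ≥0 => conv (conv ψ K) (zeroExt u) t) F := by
  have tu := isTame_zeroExt u
  -- Only frequencies in this compact set can contribute to `ψ̂ K̂`, and all of them correspond to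
  -- resolvent points.
  set S : Set ℝ := tsupport (𝓕 K) \ U with hS
  have hSc : IsCompact S := hKs.isCompact.diff hU
  choose a ha hloc using fun b : S => hu.exists_memSpace_conv hF hf (hUA b b.2.2)
  obtain ⟨T, hT⟩ := hSc.elim_finite_subcover (fun b : S => Metric.ball (b : ℝ) (a b))
    (fun b => Metric.isOpen_ball) fun ξ hξ => Set.mem_iUnion.2 ⟨⟨ξ, hξ⟩,
      Metric.mem_ball_self (ha _)⟩
  obtain ⟨p, hp⟩ := SmoothPartitionOfUnity.exists_isSubordinate 𝓘(ℝ, ℝ) hSc.isClosed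
    (fun i : T => Metric.ball ((i : S) : ℝ) (a i)) (fun i => Metric.isOpen_ball) (fun ξ hξ => by
      obtain ⟨i, hi, hξi⟩ := Set.mem_iUnion₂.1 (hT hξ)
      exact Set.mem_iUnion.2 ⟨⟨i, hi⟩, hξi⟩)
  have hχ : ∀ i, ContDiff ℝ ∞ fun ξ => (p i ξ : ℂ) * 𝓕 K ξ := fun i =>
    (Complex.ofRealCLM.contDiff.comp (p i).contMDiff.contDiff).mul hKd
  have hχs : ∀ i, HasCompactSupport fun ξ => (p i ξ : ℂ) * 𝓕 K ξ := fun i => hKs.mul_left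
  choose θ hθ using fun i => exists_schwartz_fourier_eq (hχs i) (hχ i)
  have hmem : ∀ i, MemSpace (fun t : ℝ≥0 => conv (θ i) (zeroExt u) t) F := fun i => by
    refine hloc i (θ i) fun ξ hξ => ?_
    have : p i ξ = 0 := by
      by_contra h
      have h1 := hp i (subset_tsupport _ h)
      rw [Metric.mem_ball, Real.dist_eq] at h1
      exact absurd h1 hξ.not_gt
    rw [hθ, this, Complex.ofReal_zero, zero_mul]
  have hθi : ∀ i, Integrable (θ i) := fun i => (θ i).integrable
  set Θ : ℝ → ℂ := fun t => ∑ i, θ i t with hΘ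
  have hΘi : Integrable Θ := integrable_finsetSum _ fun i _ => hθi i
  have hΘt : IsTame Θ := by
    refine IsTame.of_continuous (continuous_finsetSum _ fun i _ => (θ i).continuous)
      (C := ∑ i, ‖(θ i).toBoundedContinuousFunction‖) fun t => ?_
    exact (norm_sum_le _ _).trans (Finset.sum_le_sum fun i _ =>
      (θ i).toBoundedContinuousFunction.norm_coe_le_norm t)
  -- Transforms agree: on `U` because `ψ̂ = 0`, on `S` because the partition sums to one, elsewhere
  -- because `K̂ = 0`.
  have heq : conv ψ K = conv ψ Θ := by
    refine eq_of_fourier_eq (integrable_conv hψ hK) (integrable_conv hψ hΘi)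
      (continuous_conv hψ hKt) (continuous_conv hψ hΘt) fun ξ => ?_
    rw [fourier_conv hψ hK, fourier_conv hψ hΘi, hΘ, fourier_sum_apply _ hθi]
    by_cases hξU : ξ ∈ U
    · rw [hUψ ξ hξU, zero_mul, zero_mul]
    · simp only [hθ]
      by_cases hξK : ξ ∈ tsupport (𝓕 K)
      · have h1 := p.sum_eq_one (x := ξ) ⟨hξK, hξU⟩
        rw [finsum_eq_sum_of_fintype] at h1
        rw [← Finset.sum_mul, ← Complex.ofReal_sum, h1, Complex.ofReal_one, one_mul]
      · simp [image_eq_zero_of_notMem_tsupport hξK]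
  rw [heq]
  have hΘm : MemSpace (fun t : ℝ≥0 => conv Θ (zeroExt u) t) F :=
    (memSpace_sum Finset.univ fun i _ => hmem i).congr fun t => (sum_conv _ hθi tu _).symm
  exact (hF.memSpace_conv hψ (isTame_conv hΘi tu) hΘm).congr fun t =>
    (conv_assoc hψ hΘi tu t).symm

/-! ### Approximation by band-limited kernels -/

theorem exists_contDiff_integral_norm_sub_le {ψ : ℝ → ℂ} (hψ : Integrable ψ) {δ : ℝ}
    (hδ : 0 < δ) : ∃ c : ℝ → ℂ, HasCompactSupport c ∧ ContDiff ℝ ∞ c ∧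
      ∫ s, ‖ψ s - c s‖ ≤ δ := by
  obtain ⟨c, hcs, hcd, hc⟩ :=
    (memLp_one_iff_integrable.2 hψ).exist_eLpNorm_sub_le ENNReal.one_ne_top le_rfl hδ
  refine ⟨c, hcs, hcd, ?_⟩
  have hci : Integrable c := hcd.continuous.integrable_of_hasCompactSupport hcs
  rw [eLpNorm_one_eq_lintegral_enorm] at hc
  have h1 := integral_norm_eq_lintegral_enorm (hψ.sub hci).aestronglyMeasurable
  calc ∫ s, ‖ψ s - c s‖ = (∫⁻ s, ‖(ψ - c) s‖ₑ).toReal := h1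
    _ ≤ (ENNReal.ofReal δ).toReal := ENNReal.toReal_mono ENNReal.ofReal_ne_top hc
    _ = δ := ENNReal.toReal_ofReal hδ.le

/-- Convolution with a smooth compactly supported kernel produces Lipschitz functions. -/
theorem exists_lipschitz_conv [CompleteSpace X] {c : ℝ → ℂ} (hcs : HasCompactSupport c)
    (hcd : ContDiff ℝ ∞ c) {h : ℝ → X} (hh : IsTame h) :
    ∃ L : ℝ, 0 ≤ L ∧ ∀ s t, ‖conv c h t - conv c h s‖ ≤ L * |t - s| := by
  obtain ⟨C, hC⟩ := hh.bounded
  have hC0 : 0 ≤ C := (norm_nonneg _).trans (hC 0)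
  have hd : Integrable (deriv c) :=
    (hcd.continuous_deriv (by simp)).integrable_of_hasCompactSupport hcs.deriv
  have hloc : LocallyIntegrable h := fun x => by
    refine ⟨Metric.ball x 1, Metric.ball_mem_nhds _ one_pos, ?_⟩
    exact Measure.integrableOn_of_bounded (M := C) measure_ball_lt_top.ne
      hh.aestronglyMeasurable (Eventually.of_forall hC)
  have hderiv : ∀ t, HasDerivAt (conv c h) (conv (deriv c) h t) t := fun t =>
    hcs.hasDerivAt_convolution_left (ContinuousLinearMap.lsmul ℝ ℂ : ℂ →L[ℝ] X →L[ℝ] X)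
      (hcd.of_le (by simp)) hloc t
  refine ⟨(∫ s, ‖deriv c s‖) * C, by positivity, fun s t => ?_⟩
  exact convex_univ.norm_image_sub_le_of_norm_hasDerivWithin_le
    (fun x _ => (hderiv x).hasDerivWithinAt) (fun x _ => norm_conv_le hd hC x)
    (Set.mem_univ s) (Set.mem_univ t)

/-- Convolution of a bounded function with an integrable kernel is a uniform limit of its
band-limited truncations. -/
theorem exists_bandlimited_norm_sub_le [CompleteSpace X] {ψ : ℝ → ℂ} (hψ : Integrable ψ)
    {h : ℝ → X} (hh : IsTame h) {ε : ℝ} (hε : 0 < ε) : ∃ K : ℝ → ℂ, Integrable K ∧ IsTame K ∧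
      ContDiff ℝ ∞ (𝓕 K) ∧ HasCompactSupport (𝓕 K) ∧
      ∀ t, ‖conv ψ h t - conv (conv ψ K) h t‖ ≤ ε := by
  obtain ⟨C, hC⟩ := hh.bounded
  have hC0 : 0 ≤ C := (norm_nonneg _).trans (hC 0)
  obtain ⟨m, hmd, hms, hm1⟩ := exists_schwartz_fourier_eq_one
  set M := ∫ s, ‖m s‖ with hM
  have hM0 : 0 ≤ M := integral_nonneg fun _ => norm_nonneg _
  -- Replacing `ψ` by the smooth `c` costs `δC` before and `MδC` after convolution with `K`,
  -- together at most `ε / 2`.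
  set δ := ε / 2 / ((1 + M) * (C + 1)) with hδ
  obtain ⟨c, hcs, hcd, hc⟩ := exists_contDiff_integral_norm_sub_le hψ
    (by positivity : 0 < δ)
  have hci : Integrable c := hcd.continuous.integrable_of_hasCompactSupport hcs
  obtain ⟨L, hL0, hL⟩ := exists_lipschitz_conv hcs hcd hh
  set D := ∫ s : ℝ, ‖s‖ ^ 1 * ‖m s‖ with hD
  have hD0 : 0 ≤ D := integral_nonneg fun _ => by positivity
  -- Since `K` has mean one and first absolute moment `D / N`, it moves the `L`-Lipschitz function
  -- `c*h` by at most `L D / N ≤ ε / 2`.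
  set N := 2 * (L * D + 1) / ε with hN
  have hN0 : 0 < N := by positivity
  set K := dilate m N 0 with hKdef
  have hK : Integrable K := integrable_dilate m.integrable hN0 0
  have hFK : 𝓕 K = fun ξ => 𝓕 (m : ℝ → ℂ) (N⁻¹ * ξ) := by
    ext ξ
    rw [hKdef, fourier_dilate hN0, sub_zero, div_eq_inv_mul]
  have hKone : ∫ s, K s = 1 := by
    have h1 : 𝓕 K 0 = 1 := by rw [hFK]; exact hm1 _ (by simp)
    simpa [Real.fourier_real_eq] using h1
  refine ⟨K, hK, ?_, ?_, ?_, fun t => ?_⟩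
  · refine IsTame.of_continuous (continuous_dilate m.continuous 0)
      (C := N * ‖m.toBoundedContinuousFunction‖) fun t => ?_
    rw [hKdef, norm_dilate hN0]
    gcongr
    exact m.toBoundedContinuousFunction.norm_coe_le_norm _
  · rw [hFK]
    exact hmd.comp (contDiff_const.mul contDiff_id)
  · rw [hFK]
    exact hms.comp_homeomorph (Homeomorph.mulLeft₀ N⁻¹ (inv_pos.2 hN0).ne')
  · have tψ := isTame_conv hψ hh
    have tc := isTame_conv hci hh
    have hψc := hψ.sub hci
    have hsmall : ∀ s, ‖conv ψ h s - conv c h s‖ ≤ δ * C := fun s => by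
      rw [← sub_conv hψ hci hh]
      exact (norm_conv_le hψc hC s).trans (by gcongr; exact hc)
    have e1 : conv (conv ψ K) h t = conv K (conv ψ h) t := by
      rw [conv_comm ψ K, conv_assoc hK hψ hh]
    have e2 : conv c h t - conv K (conv c h) t
        = ∫ s, K s • (conv c h t - conv c h (t - s)) := by
      simp only [smul_sub]
      rw [integral_sub (hK.smul_const _) (integrable_smul_comp_sub hK tc t), integral_smul_const,
        hKone, one_smul]
      rfl
    have hKs : (fun s => ‖K s‖ * (L * |s|)) = fun s => L * (‖N * s‖ ^ 1 * ‖m (N * s)‖) := by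
      ext s
      rw [hKdef, norm_dilate hN0, pow_one, norm_mul, Real.norm_of_nonneg hN0.le,
        Real.norm_eq_abs]
      ring
    have hKi : Integrable fun s => ‖K s‖ * (L * |s|) := by
      rw [hKs]
      exact ((m.integrable_pow_mul volume 1).comp_mul_left' hN0.ne').const_mul L
    have hKI : ∫ s, ‖K s‖ * (L * |s|) = L * D / N := by
      rw [hKs, integral_const_mul, Measure.integral_comp_mul_left (fun s => ‖s‖ ^ 1 * ‖m s‖),
        abs_of_pos (inv_pos.2 hN0), smul_eq_mul]
      ring
    have e3 : ‖conv c h t - conv K (conv c h) t‖ ≤ L * D / N := by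
      rw [e2, ← hKI]
      refine norm_integral_le_of_norm_le hKi (Eventually.of_forall fun s => ?_)
      rw [norm_smul]
      gcongr
      simpa using hL (t - s) t
    have e4 : ‖conv K (conv ψ h) t - conv K (conv c h) t‖ ≤ M * (δ * C) := by
      rw [← conv_sub hK tψ tc, hM, ← integral_norm_dilate (g := m) hN0 0]
      exact norm_conv_le hK hsmall t
    have e5 : L * D / N ≤ ε / 2 := by
      rw [hN, div_div_eq_mul_div, div_le_div_iff₀ (by positivity) two_pos]
      nlinarith [mul_nonneg hL0 hD0]
    have e6 : δ * C + M * (δ * C) ≤ ε / 2 := by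
      calc δ * C + M * (δ * C) ≤ δ * ((1 + M) * (C + 1)) := by
            have : 0 ≤ δ := by positivity
            nlinarith [mul_nonneg this hM0]
        _ = ε / 2 := by
            rw [hδ]
            field_simp
    calc ‖conv ψ h t - conv (conv ψ K) h t‖
        = ‖(conv ψ h t - conv c h t) + (conv c h t - conv K (conv c h) t)
            - (conv K (conv ψ h) t - conv K (conv c h) t)‖ := by
          rw [e1]
          congr 1
          abel
      _ ≤ ‖conv ψ h t - conv c h t‖ + ‖conv c h t - conv K (conv c h) t‖
            + ‖conv K (conv ψ h) t - conv K (conv c h) t‖ :=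
          (norm_sub_le _ _).trans (add_le_add_left (norm_add_le _ _) _)
      _ ≤ δ * C + L * D / N + M * (δ * C) := add_le_add (add_le_add (hsmall t) e3) e4
      _ ≤ ε := by linarith

/-- Kernels whose Fourier transform vanishes near the imaginary spectrum filter mild solutions
into `F`. -/
theorem IsMildSolution.memSpace_conv [CompleteSpace X] {A : X →ₗ.[ℂ] X} {f u : ℝ≥0 →ᵇ X}
    (hu : IsMildSolution A f u) {F : Submodule ℂ (ℝ≥0 →ᵇ X)} (hF : ConditionFPlusPlus F)
    (hf : f ∈ F) {ψ : ℝ → ℂ} (hψ : Integrable ψ) {U : Set ℝ} (hU : IsOpen U)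
    (hUψ : ∀ ξ ∈ U, 𝓕 ψ ξ = 0)
    (hUA : ∀ b ∉ U, (2 * Real.pi * Complex.I * b : ℂ) ∈ resolventSet A) :
    MemSpace (fun t : ℝ≥0 => conv ψ (zeroExt u) t) F := by
  have tu := isTame_zeroExt u
  refine MemSpace.of_approx hF.isClosed ((continuous_conv hψ tu).comp continuous_subtype_val)
    fun ε hε => ?_
  obtain ⟨K, hK, hKt, hKd, hKs, hKε⟩ := exists_bandlimited_norm_sub_le hψ tu hε
  exact ⟨_, hu.memSpace_conv_conv hF hf hψ hK hKt hKd hKs hU hUψ hUA, fun t => hKε t⟩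

/-! ### Reflection of the kernel and spectral synthesis -/

theorem fourier_comp_neg (g : ℝ → ℂ) (ξ : ℝ) :
    𝓕 (fun r => g (-r)) ξ = fourierL1 g (-(2 * Real.pi * ξ)) := by
  rw [Real.fourier_real_eq_integral_exp_smul, fourierL1,
    ← integral_neg_eq_self (fun s : ℝ => Complex.exp _ * g s)]
  refine integral_congr_ae (Eventually.of_forall fun r => ?_)
  simp only [smul_eq_mul]
  congr 2
  push_cast
  ring

theorem integral_Ioi_smul_eq_conv {φ : ℝ → ℂ} (hφ : ∀ t < 0, φ t = 0) (h : ℝ → X) (t : ℝ) :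
    ∫ s in Set.Ioi (0 : ℝ), φ s • h (t + s) = conv (fun r => φ (-r)) h t := by
  rw [conv, ← integral_neg_eq_self (fun s => φ (-s) • h (t - s)),
    ← integral_Ici_eq_integral_Ioi, setIntegral_eq_integral_of_forall_compl_eq_zero]
  · simp
  · intro s hs
    rw [hφ s (by simpa using hs), zero_smul]

/-- `L¹` convergence of `φₙ` gives uniform convergence of the filtered solutions. The `φₙ` may
charge both half-lines, so two-sided kernels had to be treated. -/
theorem IsMildSolution.memSpace_of_spectralSynthesis [CompleteSpace X] {A : X →ₗ.[ℂ] X}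
    {f u : ℝ≥0 →ᵇ X} (hu : IsMildSolution A f u) {F : Submodule ℂ (ℝ≥0 →ᵇ X)}
    (hF : ConditionFPlusPlus F) (hf : f ∈ F) {φ : ℝ → ℂ}
    (hsyn : IsOfSpectralSynthesis φ (rotatedRealSpectrum A)) :
    MemSpace (fun t : ℝ≥0 => conv (fun r => φ (-r)) (zeroExt u) t) F := by
  obtain ⟨hφi, gn, hgn, hlim, hvan⟩ := hsyn
  have tu := isTame_zeroExt u
  have hmem : ∀ n, MemSpace (fun t : ℝ≥0 => conv (fun r => gn n (-r)) (zeroExt u) t) F := by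
    intro n
    obtain ⟨U, hU, hEU, hUg⟩ := hvan n
    refine hu.memSpace_conv hF hf (hgn n).comp_neg
      (U := (fun ξ : ℝ => -(2 * Real.pi * ξ)) ⁻¹' U) (hU.preimage (by fun_prop))
      (fun ξ hξ => (fourier_comp_neg _ _).trans (hUg _ hξ)) fun b hb => ?_
    -- Were `2πib` in the spectrum, `i · 2πib = -2πb` would lie in `E`, hence in the neighbourhood
    -- where the transform vanishes.
    by_contra hres
    refine hb (hEU ⟨_, hres, ?_⟩)
    push_cast
    linear_combination (2 * Real.pi * b : ℂ) * Complex.I_mul_I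
  refine MemSpace.of_approx hF.isClosed
    ((continuous_conv hφi.comp_neg tu).comp continuous_subtype_val) fun ε hε => ?_
  obtain ⟨n, hn⟩ := ((tendsto_order.1 hlim).2 (ε / (‖u‖ + 1)) (by positivity)).exists
  refine ⟨_, hmem n, fun t => ?_⟩
  rw [← sub_conv hφi.comp_neg (hgn n).comp_neg tu]
  refine (norm_conv_le (hφi.comp_neg.sub (hgn n).comp_neg) (norm_zeroExt_le u) _).trans ?_
  simp only [Pi.sub_apply]
  rw [integral_neg_eq_self (fun s => ‖φ s - gn n s‖)]
  calc (∫ s, ‖φ s - gn n s‖) * ‖u‖ ≤ ε / (‖u‖ + 1) * (‖u‖ + 1) := by gcongr; linarith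
    _ = ε := by field_simp

/-! ### Functions vanishing at infinity -/

variable (X) in
/-- The space of bounded continuous functions on the half-line tending to zero at infinity. -/
def vanishing : Submodule ℂ (ℝ≥0 →ᵇ X) where
  carrier := {g | Tendsto g atTop (𝓝 0)}
  add_mem' {g h} hg hh := by
    simpa [Pi.add_def] using Tendsto.add hg hh
  zero_mem' := tendsto_const_nhds
  smul_mem' c g hg := by simpa using Tendsto.const_smul hg c

theorem memSpace_vanishing {g : ℝ≥0 → X} (hg : Continuous g) {C : ℝ} (hC : ∀ t, ‖g t‖ ≤ C)
    (h0 : Tendsto g atTop (𝓝 0)) : MemSpace g (vanishing X) :=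
  ⟨BoundedContinuousFunction.ofNormedAddCommGroup g hg C hC, h0, fun _ => rfl⟩

theorem memSpace_vanishing_conv {ψ : ℝ → ℂ} (hψ : Integrable ψ) {g : ℝ≥0 →ᵇ X}
    (hg : g ∈ vanishing X) :
    MemSpace (fun t : ℝ≥0 => conv ψ (zeroExt g) t) (vanishing X) := by
  have tg := isTame_zeroExt g
  have h0 : Tendsto (zeroExt g) atTop (𝓝 0) := by
    have h1 : Tendsto g atTop (𝓝 0) := hg
    refine (h1.comp tendsto_real_toNNReal_atTop).congr' ?_
    filter_upwards [eventually_ge_atTop 0] with t ht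
    simp [zeroExt, ht]
  exact memSpace_vanishing ((continuous_conv hψ tg).comp continuous_subtype_val)
    (fun t => norm_conv_le hψ (norm_zeroExt_le g) t)
    ((tendsto_conv hψ tg h0).comp (NNReal.tendsto_coe_atTop.2 tendsto_id))

theorem isClosed_vanishing : IsClosed (vanishing X : Set (ℝ≥0 →ᵇ X)) := by
  refine isClosed_of_closure_subset fun g hg => ?_
  change Tendsto g atTop (𝓝 0)
  refine Metric.tendsto_nhds.2 fun ε hε => ?_
  obtain ⟨h, hh, hgh⟩ := Metric.mem_closure_iff.1 hg (ε / 2) (half_pos hε)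
  have hh' : Tendsto h atTop (𝓝 0) := hh
  filter_upwards [Metric.tendsto_nhds.1 hh' (ε / 2) (half_pos hε)] with t ht
  calc dist (g t) 0 ≤ dist (g t) (h t) + dist (h t) 0 := dist_triangle _ _ _
    _ < ε / 2 + ε / 2 :=
        add_lt_add (lt_of_le_of_lt (BoundedContinuousFunction.dist_coe_le_dist t) hgh) ht
    _ = ε := add_halves ε

/-- Decay survives every `L¹` convolution, and both exponential integrals are such convolutions,
with kernels `e^{zr}` on the half-line where they decay. -/
theorem conditionFPlusPlus_vanishing : ConditionFPlusPlus (vanishing X) where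
  isClosed := isClosed_vanishing
  contains_C0 _ hg := hg
  modulation g hg ξ := by
    have hn : ∀ t : ℝ≥0, ‖Complex.exp (Complex.I * ξ * (t : ℝ)) • g t‖ = ‖g t‖ := fun t => by
      rw [norm_smul, show (Complex.I * ξ * (t : ℝ) : ℂ) = ((ξ * t : ℝ) : ℂ) * Complex.I by
        push_cast; ring, Complex.norm_exp_ofReal_mul_I, one_mul]
    have hg' : Tendsto g atTop (𝓝 0) := hg
    refine memSpace_vanishing (Continuous.smul (by fun_prop) g.continuous)
      (fun t => (hn t).trans_le (g.norm_coe_le_norm t)) ?_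
    rw [tendsto_zero_iff_norm_tendsto_zero] at hg' ⊢
    simpa only [hn] using hg'
  forward h hh z hz := by
    have hi : Integrable ((Set.Iio (0 : ℝ)).indicator fun r => Complex.exp (z * r)) := by
      rw [integrable_indicator_iff measurableSet_Iio]
      exact (integrableOn_exp_mul_complex_Iic hz 0).mono_set Set.Iio_subset_Iic_self
    refine (memSpace_vanishing_conv hi hh).congr fun t => ?_
    rw [conv_swap, ← integral_indicator measurableSet_Ioi]
    refine integral_congr_ae (Eventually.of_forall fun s => ?_)
    by_cases hs : (t : ℝ) < s <;> simp [Set.indicator, hs]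
  backward h hh z hz := by
    have hi : Integrable ((Set.Ici (0 : ℝ)).indicator fun r => Complex.exp (z * r)) := by
      rw [integrable_indicator_iff measurableSet_Ici, integrableOn_Ici_iff_integrableOn_Ioi]
      exact integrableOn_exp_mul_complex_Ioi hz 0
    refine (memSpace_vanishing_conv hi hh).congr fun t => ?_
    rw [conv_indicator_Ici_zeroExt]
    simp
  comp_left B g hg := by
    have hg' : Tendsto g atTop (𝓝 0) := hg
    refine memSpace_vanishing (B.continuous.comp g.continuous) (C := ‖B‖ * ‖g‖)
      (fun t => B.le_opNorm_of_le (g.norm_coe_le_norm t)) ?_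
    simpa [Function.comp_def] using (B.continuous.tendsto 0).comp hg'
  convolution ψ hψ _ g hg := (memSpace_vanishing_conv hψ hg).congr fun t => conv_swap _ _ _

end EvolEq

theorem theorem2 {X : Type*} [NormedAddCommGroup X] [NormedSpace ℂ X] [CompleteSpace X]
    (A : X →ₗ.[ℂ] X) (hA : A.IsClosed)
    (f u : ℝ≥0 →ᵇ X) (hu : EvolEq.IsMildSolution A f u)
    (φ : ℝ → ℂ) (hφ : ∀ t < 0, φ t = 0)
    (hsyn : EvolEq.IsOfSpectralSynthesis φ (EvolEq.rotatedRealSpectrum A)) :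
    (∀ F : Submodule ℂ (ℝ≥0 →ᵇ X), EvolEq.ConditionFPlusPlus F → f ∈ F →
      EvolEq.MemSpace
        (fun t : ℝ≥0 => ∫ s in Set.Ioi (0 : ℝ), φ s • EvolEq.zeroExt u (t + s)) F) ∧
    (Tendsto f atTop (𝓝 0) →
      Tendsto (fun t : ℝ≥0 => ∫ s in Set.Ioi (0 : ℝ), φ s • EvolEq.zeroExt u (t + s))
        atTop (𝓝 0)) := by
  have main : ∀ F : Submodule ℂ (ℝ≥0 →ᵇ X), EvolEq.ConditionFPlusPlus F → f ∈ F →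
      EvolEq.MemSpace
        (fun t : ℝ≥0 => ∫ s in Set.Ioi (0 : ℝ), φ s • EvolEq.zeroExt u (t + s)) F :=
    fun F hF hf => (hu.memSpace_of_spectralSynthesis hF hf hsyn).congr fun t =>
      (EvolEq.integral_Ioi_smul_eq_conv hφ _ _).symm
  refine ⟨main, fun hf => ?_⟩
  obtain ⟨G, hG, hGw⟩ := main _ EvolEq.conditionFPlusPlus_vanishing hf
  have hG' : Tendsto G atTop (𝓝 0) := hG
  exact hG'.congr hGw
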